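/- Let $m\in\mathbb N$, and let $b=(b_{kn})$, $a=(a_{kn})$ be real numbers indexed by $1\le k\le m$, $n\in\mathbb Z$, with all $b_{kn}>0$. Let $X_m$ be the space of real matrices $x=(x_{kn})_{1\le k\le m,\,n\in\mathbb Z}$ with the product $\sigma$-algebra, and let $$\mu^m_{(b,a)}=\bigotimes_{k=1}^m\bigotimes_{n\in\mathbb Z}\mu_{(b_{kn},a_{kn})},\qquad d\mu_{(\beta,\alpha)}(u)=\sqrt{\beta/\pi}\;e^{-\beta(u-\alpha)^2}\,du ,$$ be the Gaussian product measure on $X_m$. For $t=(t_{rs})\in\mathrm{GL}(m,\mathbb R)$ put $L_t(x)=tx$, and let $(\mu^m_{(b,a)})^{L_t}(\Delta)=\mu^m_{(b,a)}(L_t^{-1}(\Delta))$ be the image measure. Put $B_n=\mathrm{diag}(b_{1n},\dots,b_{mn})$, $X_n(t)=B_n^{1/2}\,t\,B_n^{-1/2}$, and $$Q(t)=\prod_{n\in\mathbb Z}\frac{\det\left(I+X_n^*(t)X_n(t)\right)}{2^m\,|\det t|}+\sum_{n\in\mathbb Z}\sum_{r=1}^m b_{rn}\Big(\sum_{s=1}^m(t_{rs}-\delta_{rs})a_{sn}\Big)^2\in[0,\infty].$$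 Then the infinite product converges unconditionally in $[0,\infty]$ for every $t\in\mathrm{GL}(m,\mathbb R)$ (so that $Q(t)$ is well defined), and for every $t\in\mathrm{GL}(m,\mathbb R)\setminus\{e\}$ $$(\mu^m_{(b,a)})^{L_t}\perp\mu^m_{(b,a)}\iff Q(t)=\infty .$$ In particular, $(\mu^m_{(b,a)})^{L_t}\perp\mu^m_{(b,a)}$ for all $t\in\mathrm{GL}(m,\mathbb R)\setminus\{e\}$ if and only if $Q(t)=\infty$ for all $t\in\mathrm{GL}(m,\mathbb R)\setminus\{e\}$. Moreover, for all $t\in\mathrm{GL}(m,\mathbb R)$ and $n\in\mathbb Z$, $$\det\left(I+X_n^*(t)X_n(t)\right)=1+\sum_{r=1}^m\;\sum_{\substack{1\le i_1<\dots<i_r\le m\\ 1\le j_1<\dots<j_r\le m}}\Big(M^{i_1\dots i_r}_{j_1\dots j_r}(X_n(t))\Big)^2 ,$$ where $M^{i_1\dots i_r}_{j_1\dots j_r}(A)$ denotes the minor of $A$ with rows $i_1,\dots,i_r$ and columns $j_1,\dots,j_r$. -/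

import Mathlib

open MeasureTheory ProbabilityTheory
open scoped ENNReal NNReal Matrix MatrixGroups BigOperators

noncomputable section

namespace GaussianRows

/-- The space `X_m` of real matrices with `m` rows (indexed by `Fin m`) and with columns indexed
by `ℤ`; it carries the product sigma-algebra. The entry `x_{kn}` is `x (k, n)`. -/
abbrev Space (m : ℕ) : Type := Fin m × ℤ → ℝ

/-- The Gaussian measure on the line with density `(b/π)^{1/2} exp (-b (x-a)^2)`, for `b > 0`:
it has mean `a` and variance `1/(2b)`. -/
def gauss (b a : ℝ) : Measure ℝ := gaussianReal a (1 / (2 * b)).toNNReal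

instance (b a : ℝ) : IsProbabilityMeasure (gauss b a) := by
  unfold gauss; infer_instance

theorem gauss_eq_withDensity {b : ℝ} (hb : 0 < b) (a : ℝ) :
    gauss b a = volume.withDensity
      (fun x : ℝ => ENNReal.ofReal (√(b / Real.pi) * Real.exp (-b * (x - a) ^ 2))) := by
  have hpos : 0 < 1 / (2 * b) := by positivity
  have hv : (1 / (2 * b)).toNNReal ≠ 0 := by simpa using hb
  rw [gauss, gaussianReal_of_var_ne_zero _ hv]
  congr 1
  funext x
  rw [gaussianPDF, gaussianPDFReal, Real.coe_toNNReal _ hpos.le, ← Real.sqrt_inv]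
  congr 3
  · field_simp
  · field_simp

/-- The product measure `μ^m_{(b,a)} = ⨂_{k,n} μ_{(b_{kn},a_{kn})}` on `X_m`. -/
def mu {m : ℕ} (b a : Fin m → ℤ → ℝ) : Measure (Space m) :=
  Measure.infinitePi (fun p : Fin m × ℤ => gauss (b p.1 p.2) (a p.1 p.2))

/-- The left action `L_t x = t x`. -/
def leftMul {m : ℕ} (t : GL (Fin m) ℝ) (x : Space m) : Space m :=
  fun p => ∑ s, t p.1 s * x (s, p.2)

theorem measurable_leftMul {m : ℕ} (t : GL (Fin m) ℝ) : Measurable (leftMul t) := by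
  unfold leftMul; fun_prop

/-- The image measure `(μ^m_{(b,a)})^{L_t}`, that is, `Δ ↦ μ^m_{(b,a)} (L_t⁻¹ Δ)`. -/
def muL {m : ℕ} (b a : Fin m → ℤ → ℝ) (t : GL (Fin m) ℝ) : Measure (Space m) :=
  (mu b a).map (leftMul t)

/-- `X_n(t) = B_n^{1/2} t B_n^{-1/2}` with `B_n = diag (b_{1n}, ..., b_{mn})`. -/
def X {m : ℕ} (b : Fin m → ℤ → ℝ) (t : GL (Fin m) ℝ) (n : ℤ) : Matrix (Fin m) (Fin m) ℝ :=
  Matrix.diagonal (fun k => √(b k n)) * (t : Matrix (Fin m) (Fin m) ℝ)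
    * Matrix.diagonal (fun k => (√(b k n))⁻¹)

/-- The minor of `A` with rows `i_1, ..., i_r` and columns `j_1, ..., j_r`. -/
def minor {m r : ℕ} (A : Matrix (Fin m) (Fin m) ℝ) (i j : Fin r ↪o Fin m) : ℝ :=
  (A.submatrix i j).det

/-- The `n`-th factor `det (I + X_n(t)^* X_n(t)) / (2^m |det t|)`. -/
def factor {m : ℕ} (b : Fin m → ℤ → ℝ) (t : GL (Fin m) ℝ) (n : ℤ) : ℝ :=
  1 / (2 ^ m * |(t : Matrix (Fin m) (Fin m) ℝ).det|) * (1 + (X b t n)ᵀ * X b t n).det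

/-- The `n`-th term `∑_r b_{rn} (∑_s (t_{rs} - δ_{rs}) a_{sn})^2`. -/
def term {m : ℕ} (b a : Fin m → ℤ → ℝ) (t : GL (Fin m) ℝ) (n : ℤ) : ℝ :=
  ∑ r, b r n * (∑ s, (t r s - (if r = s then 1 else 0)) * a s n) ^ 2

/-- The product of the factors plus the series of the terms, as an element of `[0, ∞]`. -/
def quantity {m : ℕ} (b a : Fin m → ℤ → ℝ) (t : GL (Fin m) ℝ) : ℝ≥0∞ :=
  (∏' n : ℤ, ENNReal.ofReal (factor b t n)) + ∑' n : ℤ, ENNReal.ofReal (term b a t n)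

end GaussianRows

end

-- The columns of `x` are independent and `L_t` acts on each column separately, so both measures are
-- products over `ℤ` of mutually absolutely continuous Gaussian measures on `ℝ^m`. By Kakutani's
-- criterion (`infinitePi_withDensity_sq_mutuallySingular_iff`) they are singular exactly when
-- finite products of the affinities `∫ √(dν_n/dμ_n) dμ_n` become arbitrarily small.
--
-- Completing the square (`exists_lintegral_exp_eq`) evaluates the affinity of column `n` as
-- `F_n^(-1/2) exp (-k_n/2)`, where `F_n` is the factor in `Q(t)` and `k_n` is the minimum of the
-- sum of the two quadratic forms. This `k_n` is not the term `T_n` of the series, but `k_n ≤ T_n ≤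
-- det (1 + X_nᵀ X_n) k_n`. Moreover `F_n ≥ 1`, so the product always converges in `[0, ∞]`. If it
-- is finite, the `F_n` are bounded, and `∑ k_n` and `∑ T_n` converge together; hence the affinities
-- degenerate if and only if `Q(t) = ∞`.
--
-- The expansion in minors comes from multilinearity of the determinant and Cauchy-Binet. Its part
-- of degree one bounds the Frobenius norm of `X_n`, which is what the comparison of `T_n` with
-- `k_n` needs.

namespace MeasureTheory

-- Affinity and mutual singularity.

variable {Ω : Type*} [MeasurableSpace Ω]

/-- If `G ^ 2` is a density of `ν` with respect to `μ`, then the superlevel set `{1 ≤ G}`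
separates the two measures up to `∫ G ∂μ`. -/
theorem exists_measurableSet_le_lintegral_of_withDensity_sq (μ : Measure Ω) {G : Ω → ℝ≥0∞}
    (hG : Measurable G) :
    ∃ A, MeasurableSet A ∧ μ A ≤ ∫⁻ x, G x ∂μ ∧
      (μ.withDensity (fun x => G x ^ 2)) Aᶜ ≤ ∫⁻ x, G x ∂μ := by
  have hA : MeasurableSet {x | 1 ≤ G x} := measurableSet_le measurable_const hG
  refine ⟨{x | 1 ≤ G x}, hA, ?_, ?_⟩
  · simpa using mul_meas_ge_le_lintegral hG (μ := μ) 1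
  · rw [withDensity_apply _ hA.compl]
    refine (setLIntegral_mono' hA.compl fun x hx => ?_).trans (setLIntegral_le_lintegral _ _)
    have : G x < 1 := by simpa using hx
    rw [sq]
    exact mul_le_of_le_one_right' this.le

/-- The Cauchy-Schwarz bound for the affinity of a probability measure and a measure with
density `G ^ 2`. -/
theorem setLIntegral_le_rpow_mul_rpow (μ : Measure Ω) {G : Ω → ℝ≥0∞} (hG : Measurable G)
    {A : Set Ω} (hA : MeasurableSet A) :
    ∫⁻ x in A, G x ∂μ ≤
      (μ.withDensity (fun x => G x ^ 2) A) ^ (1 / 2 : ℝ) * (μ A) ^ (1 / 2 : ℝ) := by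
  have h := ENNReal.lintegral_mul_le_Lp_mul_Lq (μ.restrict A)
    (Real.HolderConjugate.two_two) hG.aemeasurable (aemeasurable_const (b := (1 : ℝ≥0∞)))
  simpa [withDensity_apply _ hA] using h

/-- A set that nearly separates the two measures forces a small affinity: apply Cauchy-Schwarz on
`A` and on `Aᶜ`, and in each case bound one of the two masses by `1`. -/
theorem lintegral_le_rpow_add_rpow (μ : Measure Ω) [IsProbabilityMeasure μ] {G : Ω → ℝ≥0∞}
    (hG : Measurable G) [IsProbabilityMeasure (μ.withDensity (fun x => G x ^ 2))]
    {A : Set Ω} (hA : MeasurableSet A) :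
    ∫⁻ x, G x ∂μ ≤
      (μ A) ^ (1 / 2 : ℝ) + (μ.withDensity (fun x => G x ^ 2) Aᶜ) ^ (1 / 2 : ℝ) := by
  rw [← lintegral_add_compl _ hA]
  refine add_le_add ((setLIntegral_le_rpow_mul_rpow μ hG hA).trans ?_)
    ((setLIntegral_le_rpow_mul_rpow μ hG hA.compl).trans ?_)
  · exact mul_le_of_le_one_left' (ENNReal.rpow_le_one prob_le_one (by norm_num))
  · exact mul_le_of_le_one_right' (ENNReal.rpow_le_one prob_le_one (by norm_num))

/-- The infimum `μ ⊓ ν` has total mass at most `μ A + ν Aᶜ` for every measurable `A`, hence is zero.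
-/
theorem Measure.mutuallySingular_of_forall_exists_le {μ ν : Measure Ω} [IsFiniteMeasure μ]
    [IsFiniteMeasure ν]
    (h : ∀ ε : ℝ≥0∞, 0 < ε → ∃ A, MeasurableSet A ∧ μ A ≤ ε ∧ ν Aᶜ ≤ ε) : μ ⟂ₘ ν := by
  rw [Measure.mutuallySingular_iff_disjoint, disjoint_iff_inf_le]
  set ξ := μ ⊓ ν
  have h0 : ξ Set.univ ≤ 0 := by
    refine ENNReal.le_of_forall_pos_le_add fun ε hε _ => ?_
    obtain ⟨A, hA, h1, h2⟩ := h (ε / 2 : ℝ≥0) (by simpa using hε.ne')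
    rw [zero_add, ← measure_add_measure_compl hA]
    calc ξ A + ξ Aᶜ ≤ μ A + ν Aᶜ :=
          add_le_add ((inf_le_left : ξ ≤ μ) A) ((inf_le_right : ξ ≤ ν) Aᶜ)
      _ ≤ (ε / 2 : ℝ≥0) + (ε / 2 : ℝ≥0) := add_le_add h1 h2
      _ = ε := by rw [← ENNReal.coe_add, add_halves]
  have : ξ = 0 := Measure.measure_univ_eq_zero.1 (le_antisymm h0 bot_le)
  rw [this]; exact bot_le

-- Product measures and Kakutani's criterion.

section Product

variable {ι : Type*} {E : ι → Type*} [∀ i, MeasurableSpace (E i)]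

theorem lintegral_fin_prod_eq_prod {k : ℕ} {E : Fin k → Type*} [∀ i, MeasurableSpace (E i)]
    (μ : ∀ i, Measure (E i)) [∀ i, SigmaFinite (μ i)] {f : ∀ i, E i → ℝ≥0∞}
    (hf : ∀ i, Measurable (f i)) :
    ∫⁻ x, ∏ i, f i (x i) ∂(Measure.pi μ) = ∏ i, ∫⁻ y, f i y ∂(μ i) := by
  induction k with
  | zero => simp
  | succ k ih =>
    rw [← ((measurePreserving_piFinSuccAbove μ 0).symm).lintegral_comp_emb
      (MeasurableEquiv.measurableEmbedding _), Fin.prod_univ_succ,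
      ← ih (fun i => μ i.succ) (fun i => hf i.succ),
      ← lintegral_prod_mul (hf 0).aemeasurable (Finset.measurable_prod _ fun i _ =>
        (hf i.succ).comp (measurable_pi_apply i)).aemeasurable]
    refine lintegral_congr fun x => ?_
    rw [Fin.prod_univ_succ]
    rfl

theorem lintegral_pi_prod_eq_prod [Fintype ι] (μ : ∀ i, Measure (E i))
    [∀ i, SigmaFinite (μ i)] {f : ∀ i, E i → ℝ≥0∞} (hf : ∀ i, Measurable (f i)) :
    ∫⁻ x, ∏ i, f i (x i) ∂(Measure.pi μ) = ∏ i, ∫⁻ y, f i y ∂(μ i) := by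
  let e := (Fintype.equivFin ι).symm
  rw [← (measurePreserving_piCongrLeft μ e).lintegral_comp_emb
    (MeasurableEquiv.measurableEmbedding _)]
  simp_rw [← e.prod_comp, MeasurableEquiv.coe_piCongrLeft, Equiv.piCongrLeft_apply_apply]
  exact lintegral_fin_prod_eq_prod (fun i => μ (e i)) (fun i => hf (e i))

theorem pi_withDensity [Fintype ι] (μ : ∀ i, Measure (E i))
    [∀ i, SigmaFinite (μ i)] {f : ∀ i, E i → ℝ≥0∞} (hf : ∀ i, Measurable (f i))
    [∀ i, SigmaFinite ((μ i).withDensity (f i))] :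
    Measure.pi (fun i => (μ i).withDensity (f i)) =
      (Measure.pi μ).withDensity (fun x => ∏ i, f i (x i)) := by
  refine Measure.pi_eq fun s hs => ?_
  rw [withDensity_apply _ (MeasurableSet.univ_pi hs),
    ← lintegral_indicator (MeasurableSet.univ_pi hs)]
  simp_rw [withDensity_apply _ (hs _), ← lintegral_indicator (hs _)]
  rw [← lintegral_pi_prod_eq_prod μ (fun i => (hf i).indicator (hs i))]
  refine lintegral_congr fun x => ?_
  by_cases hx : x ∈ Set.univ.pi s
  · rw [Set.indicator_of_mem hx]
    exact Finset.prod_congr rfl fun i _ => (Set.indicator_of_mem (hx i trivial) _).symm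
  · rw [Set.indicator_of_notMem hx]
    simp only [Set.mem_pi, Set.mem_univ, true_imp_iff, not_forall] at hx
    obtain ⟨i, hi⟩ := hx
    exact (Finset.prod_eq_zero (Finset.mem_univ i) (Set.indicator_of_notMem hi _)).symm

/-- **Kakutani's criterion**: two product measures whose factors have densities `(g i) ^ 2` are
mutually singular if and only if the products of the affinities `∫ g i ∂(μ i)` become arbitrarily
small. -/
theorem infinitePi_withDensity_sq_mutuallySingular_iff (μ : ∀ i, Measure (E i))
    [∀ i, IsProbabilityMeasure (μ i)] {g : ∀ i, E i → ℝ≥0∞} (hg : ∀ i, Measurable (g i))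
    [∀ i, IsProbabilityMeasure ((μ i).withDensity (fun x => g i x ^ 2))] :
    Measure.infinitePi (fun i => (μ i).withDensity (fun x => g i x ^ 2)) ⟂ₘ Measure.infinitePi μ ↔
      ∀ ε : ℝ≥0∞, 0 < ε → ∃ S : Finset ι, ∏ i ∈ S, ∫⁻ x, g i x ∂(μ i) ≤ ε := by
  set ν := fun i => (μ i).withDensity (fun x => g i x ^ 2) with hν
  have hmeas (S : Finset ι) : Measurable (fun x : ∀ i : S, E i => ∏ i : S, g i (x i)) :=
    Finset.measurable_prod _ fun i _ => (hg i).comp (measurable_pi_apply i)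
  have hpi (S : Finset ι) : Measure.pi (fun i : S => ν i) =
      (Measure.pi fun i : S => μ i).withDensity (fun x => (∏ i : S, g i (x i)) ^ 2) := by
    have := pi_withDensity (fun i : S => μ i) (f := fun i x => g i x ^ 2)
      (fun i => (hg i).pow_const 2)
    simp only [hν]
    rw [this]
    simp_rw [Finset.prod_pow]
  have hint (S : Finset ι) : ∫⁻ x, ∏ i : S, g i (x i) ∂(Measure.pi fun i : S => μ i) =
      ∏ i ∈ S, ∫⁻ x, g i x ∂(μ i) := by
    rw [lintegral_pi_prod_eq_prod (fun i : S => μ i) (f := fun i => g i) (fun i => hg i)]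
    exact Finset.prod_coe_sort S (fun i => ∫⁻ x, g i x ∂(μ i))
  constructor
  · intro hs ε hε
    obtain ⟨A, hA, hνA, hμA⟩ := hs
    -- The Cauchy-Schwarz bound will be `2√δ`, whence `δ = (ε / 2) ^ 2`.
    obtain ⟨δ, hδ, hδε⟩ : ∃ δ : ℝ, 0 < δ ∧
        ENNReal.ofReal δ ^ (1 / 2 : ℝ) + ENNReal.ofReal δ ^ (1 / 2 : ℝ) ≤ ε := by
      rcases eq_or_ne ε ⊤ with rfl | hε'
      · exact ⟨1, one_pos, le_top⟩
      have he : 0 < ε.toReal := ENNReal.toReal_pos hε.ne' hε'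
      refine ⟨(ε.toReal / 2) ^ 2, by positivity, ?_⟩
      rw [ENNReal.ofReal_rpow_of_nonneg (by positivity) (by norm_num), ← Real.sqrt_eq_rpow,
        Real.sqrt_sq (by positivity), ← ENNReal.ofReal_add (by positivity) (by positivity),
        add_halves, ENNReal.ofReal_toReal hε']
    -- Cylinders are dense for the sum of the two measures, so one cylinder approximates `Aᶜ` for
    -- both at once and the problem becomes finite-dimensional.
    obtain ⟨B, hB, hAB⟩ := (Measure.MeasureDense.of_generateFrom_isSetAlgebra_finite
      (μ := Measure.infinitePi μ + Measure.infinitePi ν) isSetAlgebra_measurableCylinders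
      generateFrom_measurableCylinders.symm).approx Aᶜ hA.compl (measure_ne_top _ _) δ hδ
    obtain ⟨S, T, hT, rfl⟩ := (mem_measurableCylinders B).1 hB
    have hμB : Measure.infinitePi μ (cylinder S T) ≤ ENNReal.ofReal δ := by
      calc Measure.infinitePi μ (cylinder S T)
          ≤ Measure.infinitePi μ (Aᶜ ∪ symmDiff Aᶜ (cylinder S T)) := by
            refine measure_mono fun x hx => ?_
            by_cases h : x ∈ Aᶜ
            · exact Or.inl h
            · exact Or.inr (Or.inr ⟨hx, h⟩)
        _ ≤ 0 + Measure.infinitePi μ (symmDiff Aᶜ (cylinder S T)) :=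
            (measure_union_le _ _).trans (by rw [hμA])
        _ ≤ (Measure.infinitePi μ + Measure.infinitePi ν) (symmDiff Aᶜ (cylinder S T)) := by
            rw [zero_add]; exact Measure.le_add_right le_rfl _
        _ ≤ _ := hAB.le
    have hνB : Measure.infinitePi ν (cylinder S Tᶜ) ≤ ENNReal.ofReal δ := by
      calc Measure.infinitePi ν (cylinder S Tᶜ)
          ≤ Measure.infinitePi ν (A ∪ symmDiff Aᶜ (cylinder S T)) := by
            refine measure_mono fun x hx => ?_
            by_cases h : x ∈ A
            · exact Or.inl h
            · exact Or.inr (Or.inl ⟨h, hx⟩)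
        _ ≤ 0 + Measure.infinitePi ν (symmDiff Aᶜ (cylinder S T)) :=
            (measure_union_le _ _).trans (by rw [hνA])
        _ ≤ (Measure.infinitePi μ + Measure.infinitePi ν) (symmDiff Aᶜ (cylinder S T)) := by
            rw [zero_add]; exact Measure.le_add_left le_rfl _
        _ ≤ _ := hAB.le
    rw [Measure.infinitePi_cylinder _ hT] at hμB
    rw [Measure.infinitePi_cylinder _ hT.compl, hpi] at hνB
    have : IsProbabilityMeasure
        ((Measure.pi fun i : S => μ i).withDensity (fun x => (∏ i : S, g i (x i)) ^ 2)) := by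
      rw [← hpi]; infer_instance
    refine ⟨S, ?_⟩
    rw [← hint]
    refine (lintegral_le_rpow_add_rpow _ (hmeas S) hT).trans (le_trans ?_ hδε)
    gcongr
  · intro h
    refine Measure.MutuallySingular.symm
      (Measure.mutuallySingular_of_forall_exists_le fun ε hε => ?_)
    obtain ⟨S, hS⟩ := h ε hε
    obtain ⟨T, hT, h1, h2⟩ := exists_measurableSet_le_lintegral_of_withDensity_sq
      (Measure.pi fun i : S => μ i) (hmeas S)
    rw [hint] at h1 h2
    rw [← hpi] at h2
    refine ⟨cylinder S T, hT.cylinder _, ?_, ?_⟩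
    · rw [Measure.infinitePi_cylinder _ hT]; exact h1.trans hS
    · rw [compl_cylinder, Measure.infinitePi_cylinder _ hT.compl]; exact h2.trans hS

end Product

end MeasureTheory

-- Determinant expansions and the Cauchy-Binet formula.

namespace Matrix

variable {n R : Type*} [Fintype n] [CommRing R]

/-- The determinant is multilinear in the rows: each row is taken from `M` (indices in `s`) or from
`1`, and the identity rows reduce the determinant to a principal minor. -/
theorem det_one_add_eq_sum_det_submatrix [DecidableEq n] (M : Matrix n n R) :
    (1 + M).det = ∑ s : Finset n, (M.submatrix ((↑) : s → n) ((↑) : s → n)).det := by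
  have h := (detRowAlternating (n := n) (R := R)).map_add_univ M.row (1 : Matrix n n R).row
  rw [add_comm]
  refine h.trans (Finset.sum_congr rfl fun s _ => ?_)
  rw [← det_piecewise_one_eq_submatrix_det]
  rfl

theorem det_mul_eq_sum_functions {r : ℕ} (A : Matrix (Fin r) n R) (B : Matrix n (Fin r) R) :
    (A * B).det = ∑ f : Fin r → n, (∏ i, A i (f i)) * (B.submatrix f id).det := by
  have h := (detRowAlternating (n := Fin r) (R := R)).toMultilinearMap.map_sum
    (fun i (k : n) => A i k • B.row k)
  have h2 : (A * B).det = (detRowAlternating (n := Fin r) (R := R)).toMultilinearMap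
      (fun i => ∑ k, A i k • B.row k) := by
    change (A * B).det = (Matrix.of fun i => ∑ k, A i k • B.row k).det
    congr 1
    ext i j
    simp [mul_apply, Finset.sum_apply]
  rw [h2, h]
  refine Finset.sum_congr rfl fun f _ => ?_
  rw [MultilinearMap.map_smul_univ]
  rfl

end Matrix

theorem OrderEmbedding.eq_of_range_eq {r : ℕ} {α : Type*} [LinearOrder α] {f g : Fin r ↪o α}
    (h : Set.range f = Set.range g) : f = g := by
  refine Set.powersetCard.ofFinEmbEquiv.injective ?_
  apply SetLike.coe_injective
  simpa [Set.powersetCard.ofFinEmbEquiv_apply] using h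

namespace Matrix

variable {n R : Type*} [Fintype n] [LinearOrder n] [CommRing R]

/-- The **Cauchy-Binet formula**. -/
theorem det_mul_eq_sum_orderEmbedding {r : ℕ} (A : Matrix (Fin r) n R) (B : Matrix n (Fin r) R) :
    (A * B).det =
      ∑ j : Fin r ↪o n, (A.submatrix id j).det * (B.submatrix j id).det := by
  classical
  have hdet (j : Fin r ↪o n) : (A.submatrix id j).det * (B.submatrix j id).det =
      ∑ σ : Equiv.Perm (Fin r), (∏ i, A i (j (σ i))) * (B.submatrix (j ∘ σ) id).det := by
    rw [← det_transpose (A.submatrix id j), det_apply', Finset.sum_mul]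
    refine Finset.sum_congr rfl fun σ _ => ?_
    have : B.submatrix (j ∘ σ) id = (B.submatrix j id).submatrix σ id := rfl
    rw [this, det_permute]
    simp only [transpose_apply, submatrix_apply, id]
    ring
  simp_rw [hdet]
  rw [det_mul_eq_sum_functions, ← Finset.sum_product', Finset.univ_product_univ,
    ← Finset.sum_filter_of_ne (p := Function.Injective)]
  · symm
    -- An injective `f` is uniquely `j ∘ σ`, with `j` the increasing enumeration of its range; a
    -- non-injective `f` contributes zero because of a repeated row.
    refine Finset.sum_bij (fun p _ => p.1 ∘ p.2) ?_ ?_ ?_ ?_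
    · intro p _
      simpa using p.1.injective
    · rintro ⟨j, σ⟩ _ ⟨j', σ'⟩ _ h
      have hj : j = j' := by
        apply OrderEmbedding.eq_of_range_eq
        have := congrArg Set.range h
        simpa [EquivLike.range_comp] using this
      subst hj
      have hσ : σ = σ' := Equiv.ext fun i => j.injective (congrFun h i)
      rw [hσ]
    · intro f hf
      have hf : Function.Injective f := by simpa using hf
      have hc : (Finset.univ.image f).card = r := by
        rw [Finset.card_image_of_injective _ hf]; simp
      set e := (Finset.univ.image f).orderIsoOfFin hc
      have hmem (i : Fin r) : f i ∈ Finset.univ.image f := by simp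
      have hinj : Function.Injective (fun i => e.symm ⟨f i, hmem i⟩) := fun a b hab =>
        hf (congrArg Subtype.val (e.symm.injective hab))
      refine ⟨((Finset.univ.image f).orderEmbOfFin hc,
        Equiv.ofBijective _ (Finite.injective_iff_bijective.1 hinj)), by simp, ?_⟩
      funext i
      have : ((e (e.symm ⟨f i, hmem i⟩) : Finset.univ.image f) : n) = f i := by simp
      exact this
    · intro p _; rfl
  · intro f _ h
    by_contra hf
    rw [Function.Injective] at hf
    push Not at hf
    obtain ⟨a, b, hab, hne⟩ := hf
    apply h
    rw [det_zero_of_row_eq hne (by funext k; simp [hab]), mul_zero]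

theorem sum_powersetCard_det_submatrix (M : Matrix n n R) (r : ℕ) :
    ∑ s ∈ (Finset.univ : Finset n).powersetCard r, (M.submatrix ((↑) : s → n) ((↑) : s → n)).det =
      ∑ i : Fin r ↪o n, (M.submatrix i i).det := by
  symm
  refine Finset.sum_bij (fun i _ => Finset.univ.map i.toEmbedding) ?_ ?_ ?_ ?_
  · intro i _; simp
  · intro i _ j _ h
    apply OrderEmbedding.eq_of_range_eq
    have := congrArg (fun s : Finset n => (s : Set n)) h
    simpa using this
  · intro s hs
    have hs : s.card = r := by simpa using hs
    exact ⟨s.orderEmbOfFin hs, Finset.mem_univ _, by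
      apply Finset.coe_injective; simp⟩
  · intro i _
    let e : Fin r ≃ (Finset.univ.map i.toEmbedding : Finset n) :=
      Equiv.ofBijective (fun k => ⟨i k, by simp⟩)
        ⟨fun a b h => i.injective (congrArg Subtype.val h), fun ⟨y, hy⟩ => by
          obtain ⟨k, -, hk⟩ := Finset.mem_map.1 hy
          exact ⟨k, Subtype.ext hk⟩⟩
    rw [← det_submatrix_equiv_self e]
    rfl

theorem det_one_add_eq_sum_principal_minors (M : Matrix n n R) :
    (1 + M).det =
      1 + ∑ r ∈ Finset.Icc 1 (Fintype.card n), ∑ i : Fin r ↪o n, (M.submatrix i i).det := by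
  rw [det_one_add_eq_sum_det_submatrix, ← Finset.powerset_univ, Finset.sum_powerset]
  simp_rw [← sum_powersetCard_det_submatrix]
  rw [Finset.card_univ, Finset.sum_range_succ', add_comm]
  congr 1
  · simp
  · rw [Finset.range_eq_Ico, Finset.sum_Ico_add' (fun r => ∑ s ∈ (Finset.univ : Finset n).powersetCard r,
      (M.submatrix ((↑) : s → n) ((↑) : s → n)).det) 0 _ 1]
    rfl

theorem det_one_add_transpose_mul_self (A : Matrix n n R) :
    (1 + Aᵀ * A).det = 1 + ∑ r ∈ Finset.Icc 1 (Fintype.card n),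
      ∑ i : Fin r ↪o n, ∑ j : Fin r ↪o n, (A.submatrix i j).det ^ 2 := by
  rw [det_one_add_eq_sum_principal_minors]
  congr 1
  refine Finset.sum_congr rfl fun r _ => ?_
  rw [Finset.sum_comm]
  refine Finset.sum_congr rfl fun j _ => ?_
  have : (Aᵀ * A).submatrix j j = Aᵀ.submatrix j id * A.submatrix id j := by
    ext; simp [mul_apply]
  rw [this, det_mul_eq_sum_orderEmbedding]
  refine Finset.sum_congr rfl fun i _ => ?_
  simp only [submatrix_submatrix, ← transpose_submatrix, det_transpose, sq]
  rfl

/-- The minors of size one bound the Frobenius norm. -/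
theorem one_add_sum_sq_le_det_one_add_transpose_mul_self (A : Matrix n n ℝ) :
    1 + ∑ i, ∑ j, A i j ^ 2 ≤ (1 + Aᵀ * A).det := by
  rw [det_one_add_transpose_mul_self]
  -- The index `r = 1` occurs in the sum only if `n` is nonempty.
  rcases isEmpty_or_nonempty n with h | h
  · simp
  have h1 : ∑ i, ∑ j, A i j ^ 2 =
      ∑ i : Fin 1 ↪o n, ∑ j : Fin 1 ↪o n, (A.submatrix i j).det ^ 2 := by
    let e : (Fin 1 ↪o n) ≃ n :=
      { toFun := fun i => i 0
        invFun := fun a => OrderEmbedding.ofStrictMono (fun _ => a) (Subsingleton.strictMono _)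
        left_inv := fun i => by ext k; simp [Subsingleton.elim k 0]
        right_inv := fun a => by simp }
    simp_rw [← e.sum_comp]
    simp only [det_unique, submatrix_apply]
    rfl
  gcongr
  rw [h1]
  exact Finset.single_le_sum (f := fun r => ∑ i : Fin r ↪o n, ∑ j : Fin r ↪o n,
    (A.submatrix i j).det ^ 2) (fun r _ => by positivity)
    (Finset.mem_Icc.2 ⟨le_rfl, Fintype.card_pos⟩)

end Matrix

-- Gaussian integrals and the affinity in one column.

namespace GaussianRows

variable {m : ℕ}

/-- Completing the square in a sum of two quadratic forms. -/
theorem exists_complete_square (D D' : Matrix (Fin m) (Fin m) ℝ)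
    (hS : (Dᵀ * D + D'ᵀ * D').det ≠ 0) (a a' : Fin m → ℝ) :
    ∃ (E : Matrix (Fin m) (Fin m) ℝ) (c : Fin m → ℝ), Eᵀ * E = Dᵀ * D + D'ᵀ * D' ∧
      ∀ x, (D *ᵥ (x - a)) ⬝ᵥ (D *ᵥ (x - a)) + (D' *ᵥ (x - a')) ⬝ᵥ (D' *ᵥ (x - a')) =
        (E *ᵥ (x - c)) ⬝ᵥ (E *ᵥ (x - c)) +
          ((D *ᵥ (c - a)) ⬝ᵥ (D *ᵥ (c - a)) + (D' *ᵥ (c - a')) ⬝ᵥ (D' *ᵥ (c - a'))) := by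
  have hpsd : (Dᵀ * D + D'ᵀ * D').PosSemidef := by
    have h1 := Matrix.posSemidef_conjTranspose_mul_self D
    have h2 := Matrix.posSemidef_conjTranspose_mul_self D'
    simpa using h1.add h2
  obtain ⟨E, hE⟩ : ∃ E : Matrix (Fin m) (Fin m) ℝ, Dᵀ * D + D'ᵀ * D' = Eᵀ * E := by
    open scoped MatrixOrder in
    obtain ⟨E, hE⟩ := CStarAlgebra.nonneg_iff_eq_star_mul_self.mp hpsd.nonneg
    exact ⟨E, by simpa [Matrix.star_eq_conjTranspose] using hE⟩
  set S := Dᵀ * D + D'ᵀ * D' with hSdef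
  -- The critical point of the summed form; at `c` the terms linear in `x - c` cancel.
  set c := S⁻¹ *ᵥ ((Dᵀ * D) *ᵥ a + (D'ᵀ * D') *ᵥ a') with hc
  have hq (M : Matrix (Fin m) (Fin m) ℝ) (u v : Fin m → ℝ) :
      (M *ᵥ u) ⬝ᵥ (M *ᵥ v) = u ⬝ᵥ ((Mᵀ * M) *ᵥ v) := by
    rw [← Matrix.mulVec_mulVec, Matrix.dotProduct_mulVec u, Matrix.vecMul_transpose]
  have hSc : (Dᵀ * D) *ᵥ (c - a) + (D'ᵀ * D') *ᵥ (c - a') = 0 := by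
    have : S *ᵥ c = (Dᵀ * D) *ᵥ a + (D'ᵀ * D') *ᵥ a' := by
      rw [hc, Matrix.mulVec_mulVec, Matrix.mul_nonsing_inv _ (isUnit_iff_ne_zero.2 hS),
        Matrix.one_mulVec]
    rw [hSdef, Matrix.add_mulVec] at this
    rw [Matrix.mulVec_sub, Matrix.mulVec_sub, sub_add_sub_comm, this, sub_self]
  refine ⟨E, c, hE.symm, fun x => ?_⟩
  have hx (b : Fin m → ℝ) (M : Matrix (Fin m) (Fin m) ℝ) :
      (M *ᵥ (x - b)) ⬝ᵥ (M *ᵥ (x - b)) = (x - c) ⬝ᵥ ((Mᵀ * M) *ᵥ (x - c)) +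
        2 * ((x - c) ⬝ᵥ ((Mᵀ * M) *ᵥ (c - b))) + (M *ᵥ (c - b)) ⬝ᵥ (M *ᵥ (c - b)) := by
    have : x - b = (x - c) + (c - b) := by abel
    rw [this, Matrix.mulVec_add, add_dotProduct, dotProduct_add, dotProduct_add,
      dotProduct_comm (M *ᵥ (c - b)) (M *ᵥ (x - c)), hq, hq]
    ring
  have h0 : (x - c) ⬝ᵥ ((Dᵀ * D) *ᵥ (c - a)) + (x - c) ⬝ᵥ ((D'ᵀ * D') *ᵥ (c - a')) = 0 := by
    rw [← dotProduct_add, hSc, dotProduct_zero]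
  rw [hx a D, hx a' D', hq E, ← hE, hSdef, Matrix.add_mulVec, dotProduct_add]
  linear_combination 2 * h0

theorem lintegral_comp_mulVec {t : Matrix (Fin m) (Fin m) ℝ} (ht : t.det ≠ 0)
    {f : (Fin m → ℝ) → ℝ≥0∞} (hf : Measurable f) :
    ∫⁻ x, f (t *ᵥ x) = ENNReal.ofReal |t.det|⁻¹ * ∫⁻ y, f y := by
  have hm : Measurable (Matrix.toLin' t) :=
    (LinearMap.continuous_on_pi _).measurable
  have h := lintegral_map (μ := volume) hf hm
  rw [Real.map_matrix_volume_pi_eq_smul_volume_pi ht, lintegral_smul_measure, abs_inv] at h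
  simpa using h.symm

theorem dotProduct_self_eq_sum_sq (x : Fin m → ℝ) : x ⬝ᵥ x = ∑ i, x i ^ 2 := by
  simp [dotProduct, sq]

theorem lintegral_exp_neg_half_dotProduct :
    ∫⁻ x : Fin m → ℝ, ENNReal.ofReal (Real.exp (-(x ⬝ᵥ x) / 2)) =
      ENNReal.ofReal (√(2 * Real.pi) ^ m) := by
  have h1 (x : Fin m → ℝ) : Real.exp (-(x ⬝ᵥ x) / 2) = ∏ i, Real.exp (-(1 / 2) * x i ^ 2) := by
    rw [← Real.exp_sum, ← Finset.mul_sum]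
    congr 1
    simp only [dotProduct, ← sq]
    ring
  simp_rw [h1]
  rw [← ofReal_integral_eq_lintegral_ofReal]
  · rw [integral_fintype_prod_volume_eq_prod (fun _ : Fin m => fun y : ℝ =>
      Real.exp (-(1 / 2) * y ^ 2))]
    simp only [integral_gaussian, Finset.prod_const, Finset.card_univ, Fintype.card_fin]
    congr 3
    ring
  · exact Integrable.fintype_prod (fun _ => integrable_exp_neg_mul_sq (by norm_num))
  · exact Filter.Eventually.of_forall fun x => Finset.prod_nonneg fun i _ => (Real.exp_pos _).le

theorem lintegral_exp_neg_half_mulVec {E : Matrix (Fin m) (Fin m) ℝ} (hE : E.det ≠ 0)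
    (c : Fin m → ℝ) :
    ∫⁻ x : Fin m → ℝ, ENNReal.ofReal
        (Real.exp (-((E *ᵥ (x - c)) ⬝ᵥ (E *ᵥ (x - c))) / 2)) =
      ENNReal.ofReal (√(2 * Real.pi) ^ m / |E.det|) := by
  have hmeas : Measurable fun x : Fin m → ℝ => ENNReal.ofReal (Real.exp (-(x ⬝ᵥ x) / 2)) := by
    unfold dotProduct; fun_prop
  rw [lintegral_sub_right_eq_self (fun x => ENNReal.ofReal
        (Real.exp (-((E *ᵥ x) ⬝ᵥ (E *ᵥ x)) / 2))) c, lintegral_comp_mulVec hE hmeas,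
    lintegral_exp_neg_half_dotProduct, ← ENNReal.ofReal_mul (by positivity), div_eq_inv_mul]

/-- Cauchy-Schwarz, with the Frobenius norm bounding the action of `Y`. It controls the displacement
of the mean by the minimum of the two quadratic forms. -/
theorem dotProduct_self_sub_mulVec_le (Y : Matrix (Fin m) (Fin m) ℝ) (u w : Fin m → ℝ) :
    (u - Y *ᵥ w) ⬝ᵥ (u - Y *ᵥ w) ≤ (1 + ∑ i, ∑ j, Y i j ^ 2) * (u ⬝ᵥ u + w ⬝ᵥ w) := by
  have hYw : ∑ i, (Y *ᵥ w) i ^ 2 ≤ (∑ i, ∑ j, Y i j ^ 2) * ∑ j, w j ^ 2 := by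
    rw [Finset.sum_mul]
    exact Finset.sum_le_sum fun i _ => Finset.sum_mul_sq_le_sq_mul_sq Finset.univ (Y i) w
  have hcs : (∑ i, u i * (Y *ᵥ w) i) ^ 2 ≤ (∑ i, u i ^ 2) * ∑ i, (Y *ᵥ w) i ^ 2 :=
    Finset.sum_mul_sq_le_sq_mul_sq _ _ _
  simp only [dotProduct_self_eq_sum_sq]
  have key (i : Fin m) : (u - Y *ᵥ w) i ^ 2 =
      u i ^ 2 + (Y *ᵥ w) i ^ 2 - 2 * (u i * (Y *ᵥ w) i) := by
    simp only [Pi.sub_apply]; ring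
  simp_rw [key]
  rw [Finset.sum_sub_distrib, Finset.sum_add_distrib, ← Finset.mul_sum]
  have hF : 0 ≤ ∑ i, ∑ j, Y i j ^ 2 := by positivity
  have hU : 0 ≤ ∑ i, u i ^ 2 := by positivity
  have hW : 0 ≤ ∑ i, w i ^ 2 := by positivity
  generalize ∑ i, ∑ j, Y i j ^ 2 = F at *
  generalize ∑ i, u i ^ 2 = U at *
  generalize ∑ i, w i ^ 2 = W at *
  generalize ∑ i, (Y *ᵥ w) i ^ 2 = V at *
  generalize ∑ i, u i * (Y *ᵥ w) i = P at *
  have hP : P ^ 2 ≤ (U * F) * W := by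
    refine hcs.trans ?_
    rw [mul_assoc]
    exact mul_le_mul_of_nonneg_left hYw hU
  -- The arithmetic-geometric mean inequality `4 (U F) W ≤ (U F + W) ^ 2`.
  have h2 : -(U * F + W) ≤ 2 * P := by
    have : (2 * P) ^ 2 ≤ (U * F + W) ^ 2 := by
      linarith [sq_nonneg (U * F - W), hP]
    exact (abs_le_of_sq_le_sq' this (by positivity)).1
  linarith

/-- The affinity of two Gaussian densities with precision square roots `D` and `D * t⁻¹` and
means `a` and `t *ᵥ a`. -/
theorem exists_lintegral_exp_eq {D t : Matrix (Fin m) (Fin m) ℝ} (hD : D.det ≠ 0)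
    (ht : t.det ≠ 0) (a : Fin m → ℝ) :
    ∃ k : ℝ, 0 ≤ k ∧
      (D *ᵥ (t *ᵥ a - a)) ⬝ᵥ (D *ᵥ (t *ᵥ a - a)) ≤
        (1 + (D * t * D⁻¹)ᵀ * (D * t * D⁻¹)).det * k ∧
      k ≤ (D *ᵥ (t *ᵥ a - a)) ⬝ᵥ (D *ᵥ (t *ᵥ a - a)) ∧
      ∫⁻ x : Fin m → ℝ, ENNReal.ofReal (|D.det| / √Real.pi ^ m * √(|t.det|⁻¹) *
        Real.exp (-((D *ᵥ (x - a)) ⬝ᵥ (D *ᵥ (x - a)) +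
          ((D * t⁻¹) *ᵥ (x - t *ᵥ a)) ⬝ᵥ ((D * t⁻¹) *ᵥ (x - t *ᵥ a))) / 2)) =
      ENNReal.ofReal ((√(1 / (2 ^ m * |t.det|) *
        (1 + (D * t * D⁻¹)ᵀ * (D * t * D⁻¹)).det))⁻¹ * Real.exp (-k / 2)) := by
  set Y := D * t * D⁻¹ with hY
  set d := (1 + Yᵀ * Y).det with hd
  have hfrob : 1 + ∑ i, ∑ j, Y i j ^ 2 ≤ d :=
    Matrix.one_add_sum_sq_le_det_one_add_transpose_mul_self Y
  have hd1 : 1 ≤ d := le_trans (le_add_of_nonneg_right (by positivity)) hfrob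
  have hDu : IsUnit D.det := isUnit_iff_ne_zero.2 hD
  have htu : IsUnit t.det := isUnit_iff_ne_zero.2 ht
  have hYD : Y * D = D * t := by
    rw [hY, Matrix.mul_assoc, Matrix.nonsing_inv_mul _ hDu, Matrix.mul_one]
  -- With `Y = D t D⁻¹` one has `Y (D t⁻¹) = D`; this factorization produces `det (1 + Yᵀ Y)`.
  have hSeq : Dᵀ * D + (D * t⁻¹)ᵀ * (D * t⁻¹) = (D * t⁻¹)ᵀ * (1 + Yᵀ * Y) * (D * t⁻¹) := by
    have h1 : Y * (D * t⁻¹) = D := by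
      rw [← Matrix.mul_assoc, hYD, Matrix.mul_assoc, Matrix.mul_nonsing_inv _ htu, Matrix.mul_one]
    have h2 : (D * t⁻¹)ᵀ * (Yᵀ * Y) * (D * t⁻¹) = (Y * (D * t⁻¹))ᵀ * (Y * (D * t⁻¹)) := by
      rw [Matrix.transpose_mul Y]; simp only [Matrix.mul_assoc]
    rw [Matrix.mul_add, Matrix.add_mul, h2, h1, Matrix.mul_one, add_comm]
  have hSdet : (Dᵀ * D + (D * t⁻¹)ᵀ * (D * t⁻¹)).det = d * (D.det / t.det) ^ 2 := by
    rw [hSeq, Matrix.det_mul, Matrix.det_mul, Matrix.det_transpose, Matrix.det_mul,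
      Matrix.det_nonsing_inv, Ring.inverse_eq_inv', ← hd]
    ring
  have hS0 : (Dᵀ * D + (D * t⁻¹)ᵀ * (D * t⁻¹)).det ≠ 0 := by
    rw [hSdet]; positivity
  obtain ⟨E, c, hE, hsq⟩ := exists_complete_square D (D * t⁻¹) hS0 a (t *ᵥ a)
  have hEdet : E.det ^ 2 = d * (D.det / t.det) ^ 2 := by
    rw [← hSdet, ← hE, Matrix.det_mul, Matrix.det_transpose, sq]
  have hE0 : E.det ≠ 0 := by
    intro h; rw [h] at hEdet
    have : 0 < d * (D.det / t.det) ^ 2 := by positivity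
    simp [← hEdet] at this
  have hEabs : |E.det| = √d * (|D.det| / |t.det|) := by
    rw [← Real.sqrt_sq_eq_abs, hEdet, Real.sqrt_mul (by positivity), Real.sqrt_sq_eq_abs, abs_div]
  set u := D *ᵥ (c - a) with hu
  set w := (D * t⁻¹) *ᵥ (c - t *ᵥ a) with hw
  set k := u ⬝ᵥ u + w ⬝ᵥ w with hk
  have hnn (v : Fin m → ℝ) : 0 ≤ v ⬝ᵥ v := by
    rw [dotProduct_self_eq_sum_sq]; positivity
  have hk0 : 0 ≤ k := add_nonneg (hnn u) (hnn w)
  refine ⟨k, hk0, ?_, ?_, ?_⟩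
  -- Both residual vectors at `c` are used: `Y` carries `w` to `D (c - t a)`, so `c` cancels in `u -
  -- Y w`.
  · have hvec : D *ᵥ (t *ᵥ a - a) = u - Y *ᵥ w := by
      have h1 : Y *ᵥ w = D *ᵥ (c - t *ᵥ a) := by
        rw [hw, Matrix.mulVec_mulVec, ← Matrix.mul_assoc, hYD, Matrix.mul_assoc,
          Matrix.mul_nonsing_inv _ htu, Matrix.mul_one]
      rw [h1, hu, ← Matrix.mulVec_sub]
      congr 1; abel
    rw [hvec]
    refine le_trans ?_ (mul_le_mul_of_nonneg_right hfrob hk0)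
    exact dotProduct_self_sub_mulVec_le Y u w
  -- At `x = t a` the second form vanishes, and the first is at least the minimum `k`.
  · have h := hsq (t *ᵥ a)
    rw [sub_self (t *ᵥ a), Matrix.mulVec_zero, zero_dotProduct, add_zero] at h
    rw [h]
    exact le_add_of_nonneg_left (hnn _)
  · have h1 (x : Fin m → ℝ) : ENNReal.ofReal (|D.det| / √Real.pi ^ m * √(|t.det|⁻¹) *
        Real.exp (-((D *ᵥ (x - a)) ⬝ᵥ (D *ᵥ (x - a)) +
          ((D * t⁻¹) *ᵥ (x - t *ᵥ a)) ⬝ᵥ ((D * t⁻¹) *ᵥ (x - t *ᵥ a))) / 2)) =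
        ENNReal.ofReal (|D.det| / √Real.pi ^ m * √(|t.det|⁻¹) * Real.exp (-k / 2)) *
          ENNReal.ofReal (Real.exp (-((E *ᵥ (x - c)) ⬝ᵥ (E *ᵥ (x - c))) / 2)) := by
      rw [hsq x, ← ENNReal.ofReal_mul (by positivity), mul_assoc _ (Real.exp _) (Real.exp _),
        ← Real.exp_add]
      congr 3
      ring
    simp_rw [h1]
    rw [lintegral_const_mul _ (by unfold dotProduct; unfold Matrix.mulVec dotProduct; fun_prop),
      lintegral_exp_neg_half_mulVec hE0, ← ENNReal.ofReal_mul (by positivity)]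
    congr 1
    have hpi : √(2 * Real.pi) ^ m = √(2 ^ m) * √Real.pi ^ m := by
      have : √((2 : ℝ) ^ m) = √2 ^ m := by
        rw [Real.sqrt_eq_iff_mul_self_eq (by positivity) (by positivity), ← mul_pow,
          Real.mul_self_sqrt (by norm_num)]
      rw [Real.sqrt_mul (by norm_num), mul_pow, this]
    rw [hEabs, hpi, Real.sqrt_mul (by positivity), Real.sqrt_div (by norm_num),
      Real.sqrt_mul (by positivity), Real.sqrt_inv, Real.sqrt_one]
    have ht' : |t.det| = √|t.det| * √|t.det| := (Real.mul_self_sqrt (abs_nonneg _)).symm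
    have : 0 < √|t.det| := by positivity
    have : 0 < √Real.pi := by positivity
    have : 0 < |D.det| := by positivity
    have : 0 < √d := by positivity
    have : 0 < √((2:ℝ) ^ m) := by positivity
    rw [show |D.det| / |t.det| = |D.det| / (√|t.det| * √|t.det|) by rw [← ht']]
    field_simp

end GaussianRows

-- Infinite products and series in `[0, ∞]`.

theorem ENNReal.hasProd_iSup_of_one_le {ι : Type*} {f : ι → ℝ≥0∞} (hf : ∀ i, 1 ≤ f i) :
    HasProd f (⨆ S : Finset ι, ∏ i ∈ S, f i) := by
  have hmono : Monotone fun S : Finset ι => ∏ i ∈ S, f i := fun S T h =>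
    Finset.prod_le_prod_of_subset_of_one_le' h fun i _ _ => hf i
  simpa [HasProd] using tendsto_atTop_iSup hmono

/-- Boundedness of the products of `(√F i)⁻¹ * exp (-k i / 2)` away from zero, in terms of
comparable sequences. -/
theorem forall_exists_prod_le_iff_tprod_add_tsum_eq_top {ι : Type*} {F k T : ι → ℝ} {C : ℝ}
    (hC : 0 ≤ C) (hF : ∀ i, 1 ≤ F i) (hk : ∀ i, 0 ≤ k i) (hkT : ∀ i, k i ≤ T i)
    (hTk : ∀ i, T i ≤ C * F i * k i) :
    (∀ ε : ℝ≥0∞, 0 < ε → ∃ S : Finset ι,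
      ∏ i ∈ S, ENNReal.ofReal ((√(F i))⁻¹ * Real.exp (-k i / 2)) ≤ ε) ↔
      (∏' i, ENNReal.ofReal (F i)) + ∑' i, ENNReal.ofReal (T i) = ⊤ := by
  have hF0 (i : ι) : 0 ≤ F i := zero_le_one.trans (hF i)
  have hT0 (i : ι) : 0 ≤ T i := (hk i).trans (hkT i)
  have hprod (S : Finset ι) : ∏ i ∈ S, ENNReal.ofReal ((√(F i))⁻¹ * Real.exp (-k i / 2)) =
      ENNReal.ofReal ((√(∏ i ∈ S, F i))⁻¹ * Real.exp (-(∑ i ∈ S, k i) / 2)) := by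
    rw [← ENNReal.ofReal_prod_of_nonneg (fun i _ => by positivity), Finset.prod_mul_distrib,
      Finset.prod_inv_distrib, Real.sqrt_prod _ (fun i _ => hF0 i), ← Real.exp_sum,
      ← Finset.sum_div, Finset.sum_neg_distrib]
  have hP1 (S : Finset ι) : 1 ≤ ∏ i ∈ S, F i := Finset.one_le_prod fun i _ => hF i
  have hQ : ∏' i, ENNReal.ofReal (F i) = ⨆ S : Finset ι, ∏ i ∈ S, ENNReal.ofReal (F i) :=
    (ENNReal.hasProd_iSup_of_one_le fun i => by simpa using hF i).tprod_eq
  simp_rw [hprod]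
  constructor
  · contrapose!
    intro h
    obtain ⟨hP, hS⟩ := ENNReal.add_ne_top.1 h
    set P := ∏' i, ENNReal.ofReal (F i)
    set σ := ∑' i, ENNReal.ofReal (T i)
    have hPS (S : Finset ι) : ∏ i ∈ S, F i ≤ P.toReal := by
      rw [← ENNReal.ofReal_le_iff_le_toReal hP, ENNReal.ofReal_prod_of_nonneg fun i _ => hF0 i, hQ]
      exact le_iSup (fun S : Finset ι => ∏ i ∈ S, ENNReal.ofReal (F i)) S
    have hSS (S : Finset ι) : ∑ i ∈ S, k i ≤ σ.toReal := by
      refine (Finset.sum_le_sum fun i _ => hkT i).trans ?_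
      rw [← ENNReal.ofReal_le_iff_le_toReal hS, ENNReal.ofReal_sum_of_nonneg fun i _ => hT0 i]
      exact ENNReal.sum_le_tsum S
    have hP0 : 0 < P.toReal := lt_of_lt_of_le (by simp) (hPS ∅)
    set e := (√P.toReal)⁻¹ * Real.exp (-σ.toReal / 2)
    have he : 0 < e := by positivity
    -- All the products are at least `e`; halving makes the inequality strict.
    refine ⟨ENNReal.ofReal (e / 2), by simpa using he, fun S => ?_⟩
    have hpos : 0 < √(∏ i ∈ S, F i) := Real.sqrt_pos.2 (zero_lt_one.trans_le (hP1 S))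
    refine (ENNReal.ofReal_lt_ofReal_iff_of_nonneg (by positivity)).2
      (lt_of_lt_of_le (half_lt_self he) ?_)
    refine mul_le_mul ?_ ?_ (Real.exp_pos _).le (by positivity)
    · exact inv_anti₀ hpos (Real.sqrt_le_sqrt (hPS S))
    · exact Real.exp_le_exp.2 (by linarith [hSS S])
  · contrapose!
    rintro ⟨ε, hε, h⟩
    obtain ⟨e, he, heε⟩ : ∃ e : ℝ, 0 < e ∧ ENNReal.ofReal e ≤ ε := by
      have : ε ≠ ⊤ := (h ∅).ne_top
      exact ⟨ε.toReal, ENNReal.toReal_pos hε.ne' this, (ENNReal.ofReal_toReal this).le⟩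
    have hle (S : Finset ι) : e ≤ (√(∏ i ∈ S, F i))⁻¹ * Real.exp (-(∑ i ∈ S, k i) / 2) :=
      (ENNReal.ofReal_le_ofReal_iff (by positivity)).1 (heε.trans (h S).le)
    -- Both the inverse root and the exponential are at most `1`, so a lower bound for their product
    -- bounds each from below separately.
    have hPS (S : Finset ι) : ∏ i ∈ S, F i ≤ (e⁻¹) ^ 2 := by
      have h1 : e ≤ (√(∏ i ∈ S, F i))⁻¹ := (hle S).trans
        (mul_le_of_le_one_right (by positivity) (Real.exp_le_one_iff.2
          (by linarith [Finset.sum_nonneg fun i (_ : i ∈ S) => hk i])))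
      have h2 : √(∏ i ∈ S, F i) ≤ e⁻¹ := by
        rw [← inv_inv √(∏ i ∈ S, F i)]; exact inv_anti₀ he h1
      exact (Real.sqrt_le_left (by positivity)).1 h2
    have hkS (S : Finset ι) : ∑ i ∈ S, k i ≤ -2 * Real.log e := by
      have h1 : e ≤ Real.exp (-(∑ i ∈ S, k i) / 2) := (hle S).trans
        (mul_le_of_le_one_left (Real.exp_pos _).le
          (inv_le_one_of_one_le₀ (Real.one_le_sqrt.2 (hP1 S))))
      have := (Real.log_le_iff_le_exp he).2 h1
      linarith
    refine ENNReal.add_ne_top.2 ⟨?_, ?_⟩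
    · rw [hQ]
      refine ne_top_of_le_ne_top (ENNReal.ofReal_ne_top (r := (e⁻¹) ^ 2)) (iSup_le fun S => ?_)
      rw [← ENNReal.ofReal_prod_of_nonneg fun i _ => hF0 i]
      exact ENNReal.ofReal_le_ofReal (hPS S)
    · rw [ENNReal.tsum_eq_iSup_sum]
      refine ne_top_of_le_ne_top
        (ENNReal.ofReal_ne_top (r := C * (e⁻¹) ^ 2 * (-2 * Real.log e))) (iSup_le fun S => ?_)
      rw [← ENNReal.ofReal_sum_of_nonneg fun i _ => hT0 i]
      refine ENNReal.ofReal_le_ofReal ?_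
      -- Singletons in `hPS` bound every `F i` uniformly, so `T` is dominated by a constant multiple
      -- of `k`.
      calc ∑ i ∈ S, T i ≤ ∑ i ∈ S, C * (e⁻¹) ^ 2 * k i := Finset.sum_le_sum fun i _ => by
            refine (hTk i).trans ?_
            have : F i ≤ (e⁻¹) ^ 2 := by simpa using hPS {i}
            gcongr
            exact hk i
        _ = C * (e⁻¹) ^ 2 * ∑ i ∈ S, k i := by rw [Finset.mul_sum]
        _ ≤ _ := mul_le_mul_of_nonneg_left (hkS S) (by positivity)

-- Densities of linear images of Gaussian measures.

namespace GaussianRows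

variable {m : ℕ}

theorem measurable_mulVec (M : Matrix (Fin m) (Fin m) ℝ) :
    Measurable (fun x : Fin m → ℝ => M *ᵥ x) := by
  unfold Matrix.mulVec dotProduct; fun_prop

theorem map_mulVec_withDensity {t : Matrix (Fin m) (Fin m) ℝ} (ht : t.det ≠ 0)
    {f : (Fin m → ℝ) → ℝ≥0∞} (hf : Measurable f) :
    (volume.withDensity f).map (fun x => t *ᵥ x) =
      volume.withDensity (fun y => ENNReal.ofReal |t.det|⁻¹ * f (t⁻¹ *ᵥ y)) := by
  have hft : Measurable fun y => f (t⁻¹ *ᵥ y) := hf.comp (measurable_mulVec t⁻¹)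
  ext s hs
  rw [Measure.map_apply (measurable_mulVec t) hs, withDensity_apply _ hs, withDensity_apply _ (measurable_mulVec t hs),
    lintegral_const_mul _ hft, ← lintegral_indicator (measurable_mulVec t hs), ← lintegral_indicator hs,
    ← lintegral_comp_mulVec ht (hft.indicator hs)]
  refine lintegral_congr fun x => ?_
  by_cases hx : t *ᵥ x ∈ s
  · rw [Set.indicator_of_mem hx, Set.indicator_of_mem (by exact hx), Matrix.mulVec_mulVec,
      Matrix.nonsing_inv_mul _ (isUnit_iff_ne_zero.2 ht), Matrix.one_mulVec]
  · rw [Set.indicator_of_notMem hx, Set.indicator_of_notMem (by exact hx)]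

theorem det_diagonal_sqrt_pos {β : Fin m → ℝ} (hβ : ∀ k, 0 < β k) :
    0 < (Matrix.diagonal fun k => √(β k)).det := by
  rw [Matrix.det_diagonal]
  exact Finset.prod_pos fun k _ => Real.sqrt_pos.2 (hβ k)

theorem pi_gauss_eq_withDensity {β : Fin m → ℝ} (hβ : ∀ k, 0 < β k) (α : Fin m → ℝ) :
    Measure.pi (fun k => gauss (β k) (α k)) = volume.withDensity (fun x =>
      ENNReal.ofReal (|(Matrix.diagonal fun k => √(β k)).det| / √Real.pi ^ m *
        Real.exp (-(((Matrix.diagonal fun k => √(β k)) *ᵥ (x - α)) ⬝ᵥ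
          ((Matrix.diagonal fun k => √(β k)) *ᵥ (x - α)))))) := by
  have h1 (k : Fin m) := gauss_eq_withDensity (hβ k) (α k)
  have hp (k : Fin m) : IsProbabilityMeasure (volume.withDensity (fun x : ℝ =>
      ENNReal.ofReal (√(β k / Real.pi) * Real.exp (-β k * (x - α k) ^ 2)))) := by
    rw [← h1]; infer_instance
  simp_rw [h1]
  rw [pi_withDensity (fun _ : Fin m => (volume : Measure ℝ)) (fun k => by fun_prop)]
  congr 1
  funext x
  rw [← ENNReal.ofReal_prod_of_nonneg (fun k _ => by positivity), Finset.prod_mul_distrib,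
    ← Real.exp_sum, abs_of_pos (det_diagonal_sqrt_pos hβ), Matrix.det_diagonal,
    dotProduct_self_eq_sum_sq]
  congr 2
  · simp [Real.sqrt_div (hβ _).le, Finset.prod_div_distrib]
  · simp [Matrix.mulVec_diagonal, mul_pow, Real.sq_sqrt (hβ _).le]

/-- The square root of the density of the image of `Measure.pi` of Gaussian measures under a
linear map with respect to `Measure.pi` itself. -/
noncomputable def rootDensity (D t : Matrix (Fin m) (Fin m) ℝ) (α x : Fin m → ℝ) : ℝ≥0∞ :=
  ENNReal.ofReal (√(|t.det|⁻¹) * Real.exp (((D *ᵥ (x - α)) ⬝ᵥ (D *ᵥ (x - α)) -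
    ((D * t⁻¹) *ᵥ (x - t *ᵥ α)) ⬝ᵥ ((D * t⁻¹) *ᵥ (x - t *ᵥ α))) / 2))

theorem measurable_rootDensity (D t : Matrix (Fin m) (Fin m) ℝ) (α : Fin m → ℝ) :
    Measurable (rootDensity D t α) := by
  unfold rootDensity Matrix.mulVec dotProduct; fun_prop

theorem map_mulVec_pi_gauss {β : Fin m → ℝ} (hβ : ∀ k, 0 < β k) (α : Fin m → ℝ)
    {t : Matrix (Fin m) (Fin m) ℝ} (ht : t.det ≠ 0) :
    (Measure.pi (fun k => gauss (β k) (α k))).map (fun x => t *ᵥ x) =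
      (Measure.pi (fun k => gauss (β k) (α k))).withDensity
        (fun x => rootDensity (Matrix.diagonal fun k => √(β k)) t α x ^ 2) := by
  have hg := measurable_rootDensity (Matrix.diagonal fun k => √(β k)) t α
  rw [pi_gauss_eq_withDensity hβ α]
  generalize hD : (Matrix.diagonal fun k => √(β k)) = D at *
  have hp : Measurable fun x : Fin m → ℝ => ENNReal.ofReal (|D.det| / √Real.pi ^ m *
        Real.exp (-((D *ᵥ (x - α)) ⬝ᵥ (D *ᵥ (x - α))))) := by
    unfold Matrix.mulVec dotProduct; fun_prop
  rw [map_mulVec_withDensity ht hp, ← withDensity_mul _ hp (hg.pow_const 2)]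
  congr 1
  funext y
  have hy : D *ᵥ (t⁻¹ *ᵥ y - α) = (D * t⁻¹) *ᵥ (y - t *ᵥ α) := by
    rw [← Matrix.mulVec_mulVec, Matrix.mulVec_sub t⁻¹, Matrix.mulVec_mulVec,
      Matrix.nonsing_inv_mul _ (isUnit_iff_ne_zero.2 ht), Matrix.one_mulVec]
  rw [hy, Pi.mul_apply, rootDensity, ← ENNReal.ofReal_pow (by positivity),
    ← ENNReal.ofReal_mul (by positivity), ← ENNReal.ofReal_mul (by positivity), mul_pow,
    Real.sq_sqrt (by positivity), ← Real.exp_nat_mul]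
  congr 1
  rw [mul_mul_mul_comm, ← Real.exp_add, mul_left_comm, ← mul_assoc]
  congr 2
  push_cast; ring

/-- If `p`, `q` are the two Lebesgue densities, then `p √(q/p) = √(p q)`: the affinity becomes the
Lebesgue integral evaluated in `exists_lintegral_exp_eq`. -/
theorem lintegral_rootDensity {β : Fin m → ℝ} (hβ : ∀ k, 0 < β k) (α : Fin m → ℝ)
    (t : Matrix (Fin m) (Fin m) ℝ) :
    ∫⁻ x, rootDensity (Matrix.diagonal fun k => √(β k)) t α x
        ∂(Measure.pi (fun k => gauss (β k) (α k))) =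
      ∫⁻ x : Fin m → ℝ, ENNReal.ofReal (|(Matrix.diagonal fun k => √(β k)).det| / √Real.pi ^ m *
        √(|t.det|⁻¹) * Real.exp (-(((Matrix.diagonal fun k => √(β k)) *ᵥ (x - α)) ⬝ᵥ
            ((Matrix.diagonal fun k => √(β k)) *ᵥ (x - α)) +
          (((Matrix.diagonal fun k => √(β k)) * t⁻¹) *ᵥ (x - t *ᵥ α)) ⬝ᵥ
            (((Matrix.diagonal fun k => √(β k)) * t⁻¹) *ᵥ (x - t *ᵥ α))) / 2)) := by
  have hg := measurable_rootDensity (Matrix.diagonal fun k => √(β k)) t α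
  rw [pi_gauss_eq_withDensity hβ α]
  generalize hD : (Matrix.diagonal fun k => √(β k)) = D at *
  have hp : Measurable fun x : Fin m → ℝ => ENNReal.ofReal (|D.det| / √Real.pi ^ m *
        Real.exp (-((D *ᵥ (x - α)) ⬝ᵥ (D *ᵥ (x - α))))) := by
    unfold Matrix.mulVec dotProduct; fun_prop
  rw [lintegral_withDensity_eq_lintegral_mul _ hp hg]
  refine lintegral_congr fun x => ?_
  rw [Pi.mul_apply, rootDensity, ← ENNReal.ofReal_mul (by positivity), mul_mul_mul_comm,
    ← Real.exp_add]
  congr 3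
  ring

theorem X_eq {b : Fin m → ℤ → ℝ} (hb : ∀ k n, 0 < b k n) (t : GL (Fin m) ℝ) (n : ℤ) :
    X b t n = Matrix.diagonal (fun k => √(b k n)) * (t : Matrix (Fin m) (Fin m) ℝ) *
      (Matrix.diagonal (fun k => √(b k n)))⁻¹ := by
  rw [X]
  congr 1
  symm
  apply Matrix.inv_eq_right_inv
  rw [Matrix.diagonal_mul_diagonal, ← Matrix.diagonal_one]
  congr 1
  funext k
  exact mul_inv_cancel₀ (Real.sqrt_pos.2 (hb k n)).ne'

theorem det_coe_ne_zero (t : GL (Fin m) ℝ) : (t : Matrix (Fin m) (Fin m) ℝ).det ≠ 0 :=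
  ((Matrix.isUnit_iff_isUnit_det _).1 t.isUnit).ne_zero

theorem term_eq {b : Fin m → ℤ → ℝ} (hb : ∀ k n, 0 < b k n) (a : Fin m → ℤ → ℝ)
    (t : GL (Fin m) ℝ) (n : ℤ) :
    term b a t n =
      (Matrix.diagonal (fun k => √(b k n)) *ᵥ
        ((t : Matrix (Fin m) (Fin m) ℝ) *ᵥ (fun k => a k n) - fun k => a k n)) ⬝ᵥ
      (Matrix.diagonal (fun k => √(b k n)) *ᵥ
        ((t : Matrix (Fin m) (Fin m) ℝ) *ᵥ (fun k => a k n) - fun k => a k n)) := by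
  rw [dotProduct_self_eq_sum_sq, term]
  refine Finset.sum_congr rfl fun r _ => ?_
  rw [Matrix.mulVec_diagonal, mul_pow, Real.sq_sqrt (hb r n).le]
  simp [sub_mul, Finset.sum_sub_distrib, Matrix.mulVec, dotProduct]

theorem exists_lintegral_rootDensity_eq {b : Fin m → ℤ → ℝ} (hb : ∀ k n, 0 < b k n)
    (a : Fin m → ℤ → ℝ) (t : GL (Fin m) ℝ) (n : ℤ) :
    ∃ k : ℝ, 0 ≤ k ∧
      term b a t n ≤ 2 ^ m * |(t : Matrix (Fin m) (Fin m) ℝ).det| * factor b t n * k ∧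
      k ≤ term b a t n ∧
      ∫⁻ x, rootDensity (Matrix.diagonal fun k => √(b k n)) t (fun k => a k n) x
        ∂(Measure.pi (fun k => gauss (b k n) (a k n))) =
      ENNReal.ofReal ((√(factor b t n))⁻¹ * Real.exp (-k / 2)) := by
  have ht := det_coe_ne_zero t
  obtain ⟨k, h0, h1, h2, h3⟩ := exists_lintegral_exp_eq
    (det_diagonal_sqrt_pos fun k => hb k n).ne' ht (fun k => a k n)
  rw [← lintegral_rootDensity (fun k => hb k n), ← X_eq hb] at h3
  rw [← term_eq hb, ← X_eq hb] at h1
  rw [← term_eq hb] at h2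
  refine ⟨k, h0, ?_, h2, ?_⟩
  · convert h1 using 2
    rw [factor, add_comm]
    field_simp
  · rw [h3, factor, add_comm]

theorem factor_pos (b : Fin m → ℤ → ℝ) (t : GL (Fin m) ℝ) (n : ℤ) : 0 < factor b t n := by
  have ht := det_coe_ne_zero t
  have h : 0 < ((X b t n)ᵀ * X b t n + 1).det := by
    rw [add_comm]
    refine lt_of_lt_of_le ?_ (Matrix.one_add_sum_sq_le_det_one_add_transpose_mul_self (X b t n))
    positivity
  rw [factor, add_comm 1 (_ * _)]
  exact mul_pos (by positivity) h

theorem isProbabilityMeasure_withDensity_rootDensity {b : Fin m → ℤ → ℝ}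
    (hb : ∀ k n, 0 < b k n) (a : Fin m → ℤ → ℝ) (t : GL (Fin m) ℝ) (n : ℤ) :
    IsProbabilityMeasure ((Measure.pi (fun k => gauss (b k n) (a k n))).withDensity
      (fun x => rootDensity (Matrix.diagonal fun k => √(b k n)) t (fun k => a k n) x ^ 2)) := by
  rw [← map_mulVec_pi_gauss (fun k => hb k n) (fun k => a k n) (det_coe_ne_zero t)]
  exact Measure.isProbabilityMeasure_map (measurable_mulVec _).aemeasurable

/-- With mean zero the term vanishes, so `k = 0` and the affinity is exactly `factor ^ (-1/2)`; an
affinity of probability measures is at most `1`. -/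
theorem one_le_factor {b : Fin m → ℤ → ℝ} (hb : ∀ k n, 0 < b k n) (t : GL (Fin m) ℝ) (n : ℤ) :
    1 ≤ factor b t n := by
  obtain ⟨k, h0, -, h2, h3⟩ := exists_lintegral_rootDensity_eq hb 0 t n
  have hk : k = 0 := le_antisymm (h2.trans (by simp [term])) h0
  have := isProbabilityMeasure_withDensity_rootDensity hb 0 t n
  have hle := setLIntegral_le_rpow_mul_rpow (Measure.pi fun k => gauss (b k n) 0)
    (measurable_rootDensity (Matrix.diagonal fun k => √(b k n)) t 0) MeasurableSet.univ
  have h1 : ENNReal.ofReal ((√(factor b t n))⁻¹ * Real.exp (-k / 2)) ≤ 1 := by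
    rw [← h3, ← setLIntegral_univ]
    exact hle.trans (mul_le_one' (ENNReal.rpow_le_one prob_le_one (by norm_num))
      (ENNReal.rpow_le_one prob_le_one (by norm_num)))
  rw [hk, neg_zero, zero_div, Real.exp_zero, mul_one, ENNReal.ofReal_le_one,
    inv_le_one₀ (Real.sqrt_pos.2 (factor_pos b t n)), Real.one_le_sqrt] at h1
  exact h1

-- Reduction to independent columns.

/-- The rearrangement of a matrix into the family of its columns. -/
noncomputable def columns (m : ℕ) : Space m ≃ᵐ (ℤ → Fin m → ℝ) :=
  (MeasurableEquiv.piCongrLeft (fun _ => ℝ) (Equiv.prodComm (Fin m) ℤ)).trans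
    (MeasurableEquiv.curry ℤ (Fin m) ℝ)

theorem map_columns_mu (b a : Fin m → ℤ → ℝ) :
    (mu b a).map (columns m) =
      Measure.infinitePi fun n => Measure.pi fun k => gauss (b k n) (a k n) := by
  have h1 := Measure.infinitePi_map_piCongrLeft
    (μ := fun p : ℤ × Fin m => gauss (b p.2 p.1) (a p.2 p.1)) (Equiv.prodComm (Fin m) ℤ)
  have h2 := Measure.infinitePi_map_curry (fun (n : ℤ) (k : Fin m) => gauss (b k n) (a k n))
  rw [← h1, Measure.map_map (by fun_prop) (by fun_prop)] at h2
  simp_rw [Measure.infinitePi_eq_pi] at h2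
  exact h2

theorem map_columns_muL (b a : Fin m → ℤ → ℝ) (t : GL (Fin m) ℝ) :
    (muL b a t).map (columns m) =
      Measure.infinitePi fun n => (Measure.pi fun k => gauss (b k n) (a k n)).map
        (fun x => (t : Matrix (Fin m) (Fin m) ℝ) *ᵥ x) := by
  rw [← Measure.infinitePi_map_pi _ (fun _ => measurable_mulVec _), ← map_columns_mu,
    Measure.map_map (by fun_prop) (by fun_prop), muL,
    Measure.map_map (by fun_prop) (measurable_leftMul t)]
  rfl

theorem muL_mutuallySingular_mu_iff {b : Fin m → ℤ → ℝ} (hb : ∀ k n, 0 < b k n)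
    (a : Fin m → ℤ → ℝ) (t : GL (Fin m) ℝ) :
    muL b a t ⟂ₘ mu b a ↔ quantity b a t = ⊤ := by
  have hcol : muL b a t ⟂ₘ mu b a ↔
      (muL b a t).map (columns m) ⟂ₘ (mu b a).map (columns m) := by
    refine ⟨(columns m).measurableEmbedding.mutuallySingular_map, fun h => ?_⟩
    simpa using (columns m).symm.measurableEmbedding.mutuallySingular_map h
  have hmap (n : ℤ) := map_mulVec_pi_gauss (fun k => hb k n) (fun k => a k n) (det_coe_ne_zero t)
  have hprob := isProbabilityMeasure_withDensity_rootDensity hb a t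
  choose k hk0 hTk hkT hint using exists_lintegral_rootDensity_eq hb a t
  rw [hcol, map_columns_mu, map_columns_muL]
  simp_rw [hmap]
  rw [infinitePi_withDensity_sq_mutuallySingular_iff _ fun n => measurable_rootDensity _ _ _]
  simp_rw [hint]
  -- The constant `C` is `2 ^ m * |det t|`, the normalization of the factors, which does not depend
  -- on `n`.
  exact forall_exists_prod_le_iff_tprod_add_tsum_eq_top (by positivity)
    (fun n => one_le_factor hb t n) hk0 hkT hTk

end GaussianRows

theorem mainTheorem2 (m : ℕ) (b a : Fin m → ℤ → ℝ) (hb : ∀ k n, 0 < b k n) :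
    -- the infinite product converges unconditionally in `[0, ∞]`
    (∀ t : GL (Fin m) ℝ, Multipliable (fun n : ℤ => ENNReal.ofReal (GaussianRows.factor b t n))) ∧
    -- the criterion, for each `t` separately and for all `t` together
    (∀ t : GL (Fin m) ℝ, t ≠ 1 →
      (GaussianRows.muL b a t ⟂ₘ GaussianRows.mu b a ↔ GaussianRows.quantity b a t = ⊤)) ∧
    ((∀ t : GL (Fin m) ℝ, t ≠ 1 → GaussianRows.muL b a t ⟂ₘ GaussianRows.mu b a) ↔
      ∀ t : GL (Fin m) ℝ, t ≠ 1 → GaussianRows.quantity b a t = ⊤) ∧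
    -- the expansion of the determinant
    (∀ (t : GL (Fin m) ℝ) (n : ℤ),
      (1 + (GaussianRows.X b t n)ᵀ * GaussianRows.X b t n).det =
        1 + ∑ r ∈ Finset.Icc 1 m, ∑ i : Fin r ↪o Fin m, ∑ j : Fin r ↪o Fin m,
          GaussianRows.minor (GaussianRows.X b t n) i j ^ 2) := by
  refine ⟨fun t => ?_, fun t _ => GaussianRows.muL_mutuallySingular_mu_iff hb a t,
    forall₂_congr fun t _ => GaussianRows.muL_mutuallySingular_mu_iff hb a t, fun t n => ?_⟩
  · exact (ENNReal.hasProd_iSup_of_one_le fun n => by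
      simpa using GaussianRows.one_le_factor hb t n).multipliable
  · have h := Matrix.det_one_add_transpose_mul_self (GaussianRows.X b t n)
    rw [Fintype.card_fin] at h
    exact h
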